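/- Let $\Xi=\{0,1\}^{\mathbb Z}$ with the product topology and the coordinatewise partial order, and let $c:\mathbb Z\times\Xi\to[0,\infty)$ be bounded, translation invariant (i.e. $c(x+y,\eta)=c(x,\eta(\cdot+y))$ for all $x,y\in\mathbb Z$, $\eta\in\Xi$), and of finite range (i.e. for each $x$, $c(x,\cdot)$ depends on only finitely many coordinates). The one-dimensional spin system with flip rates $c$ is the Feller process on $\Xi$ with semigroup $(S(t))_{t\ge 0}$ whose generator is given, on functions $f$ that depend on finitely many coordinates, by $$\mathcal L f(\eta)=\sum_{x\in\mathbb Z}c(x,\eta)\,\bigl(f(\eta_x)-f(\eta)\bigr),$$ where $\eta_x(x)=1-\eta(x)$ and $\eta_x(y)=\eta(y)$ for $y\ne x$. For probability measures $\mu,\nu$ on $\Xi$, or on $\{0,1\}^{\{0,1,2,\dots\}}$, write $\mu\le\nu$ if $\int f\,d\mu\le\int f\,d\nu$ for every bounded measurable function $f$ that is increasing with respect to the coordinatewise partial order. The spin system is called attractive if, for all probability measures $\mu_1,\mu_2$ on $\Xi$, $\mu_1\le\mu_2$ implies $\mu_1S(t)\le\mu_2S(t)$ for all $t\ge0$. **Theorem.**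 Let $\bar\xi_t$ be an attractive spin system with flip rates $c$ as above, started from $\bar\xi_0=1_{(-\infty,0]}$, and for integers $z\ge0$ let $\mu_t(z)$ be the joint law of $(\bar\xi_t(z),\bar\xi_t(z+1),\dots)$. Then, for every $t\ge0$, the sequence $(\mu_t(z))_{z\ge0}$ is decreasing: $\mu_t(z)\ge\mu_t(z+1)$ for all $z\ge0$. -/

import Mathlib

open MeasureTheory ProbabilityTheory Filter Topology
open scoped NNReal

namespace SpinSystem

/-- The space `{0,1}^ℤ` of configurations (`true` is 1, occupied; `false` is 0, empty), with the
product topology, the product (= Borel) σ-algebra and the coordinatewise partial order. -/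
abbrev Config : Type := ℤ → Bool

/-- The configuration `η_x`: the spin at `x` is flipped, all the others are unchanged. -/
def flip (η : Config) (x : ℤ) : Config := Function.update η x (!(η x))

/-- The unit step configuration `1_{(-∞,0]}`. -/
def step : Config := fun x => decide (x ≤ 0)

/-- Flip rates: non-negative, bounded, translation invariant and of finite range. -/
structure IsFlipRate (c : ℤ → Config → ℝ) : Prop where
  nonneg : ∀ x η, 0 ≤ c x η
  bounded : ∃ C : ℝ, ∀ x η, c x η ≤ C
  translation_invariant : ∀ x y η, c (x + y) η = c x (fun u => η (u + y))
  finite_range : ∀ x, ∃ A : Finset ℤ, DependsOn (c x) (A : Set ℤ)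

/-- The pregenerator `𝓛 f (η) = ∑ₓ c(x,η) (f(η_x) - f(η))`. When `f` depends on finitely many
coordinates, only finitely many terms are nonzero. -/
noncomputable def pregenerator (c : ℤ → Config → ℝ) (f : Config → ℝ) (η : Config) : ℝ :=
  ∑' x : ℤ, c x η * (f (flip η x) - f η)

/-- A Feller semigroup on the compact space `{0,1}^ℤ`, given by its transition kernels:
`(S(t) f)(η) = ∫ f dS(t)(η, ·)`. -/
structure IsFellerSemigroup (S : ℝ≥0 → Kernel Config Config) : Prop where
  markov : ∀ t, IsMarkovKernel (S t)
  zero : S 0 = Kernel.id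
  add : ∀ s t, S (s + t) = S t ∘ₖ S s
  feller : ∀ t (f : C(Config, ℝ)), Continuous fun η => ∫ ζ, f ζ ∂(S t η)
  strongly_continuous : ∀ f : C(Config, ℝ),
    TendstoUniformly (fun (t : ℝ≥0) η => ∫ ζ, f ζ ∂(S t η)) f (𝓝[>] 0)

/-- `S` is the semigroup of the spin system with flip rates `c`: a Feller semigroup whose
infinitesimal generator (the derivative at time 0 in the uniform norm) is defined on all continuous
functions of finitely many coordinates, and is given there by `𝓛`. -/
structure IsSpinSemigroup (c : ℤ → Config → ℝ) (S : ℝ≥0 → Kernel Config Config) : Prop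
    extends IsFellerSemigroup S where
  generator : ∀ (f : C(Config, ℝ)) (A : Finset ℤ), DependsOn f (A : Set ℤ) →
    TendstoUniformly (fun (t : ℝ≥0) η => (∫ ζ, f ζ ∂(S t η) - f η) / (t : ℝ))
      (pregenerator c f) (𝓝[>] 0)

/-- The usual stochastic order `μ ≤ ν`: `∫ f dμ ≤ ∫ f dν` for all bounded (measurable) increasing
functions `f`. -/
def StochLE {α : Type*} [MeasurableSpace α] [Preorder α] (μ ν : Measure α) : Prop :=
  ∀ f : α → ℝ, Measurable f → Monotone f → (∃ C : ℝ, ∀ a, |f a| ≤ C) →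
    ∫ a, f a ∂μ ≤ ∫ a, f a ∂ν

/-- Attractiveness: `μ₁ ≤ μ₂` implies `μ₁ S(t) ≤ μ₂ S(t)` for all `t ≥ 0`. -/
def IsAttractive (S : ℝ≥0 → Kernel Config Config) : Prop :=
  ∀ μ₁ μ₂ : Measure Config, IsProbabilityMeasure μ₁ → IsProbabilityMeasure μ₂ →
    StochLE μ₁ μ₂ → ∀ t, StochLE (μ₁.bind (S t)) (μ₂.bind (S t))

/-- The history `σ(ξ_r : r ≤ s)` of a process up to time `s`. -/
abbrev history {Ω : Type*} (ξ : ℝ≥0 → Ω → Config) (s : ℝ≥0) : MeasurableSpace Ω :=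
  ⨆ r : Set.Iic s, MeasurableSpace.comap (ξ r) inferInstance

/-- `ξ` is, under `P`, a Markov process with transition semigroup `S`:
`P(ξ_{s+t} ∈ B | ξ_r, r ≤ s) = S(t)(ξ_s, B)` almost surely. No regularity of the paths is required,
so that in particular the càdlàg version of a Feller process is covered. -/
structure IsMarkovProcess {Ω : Type*} [MeasurableSpace Ω] (S : ℝ≥0 → Kernel Config Config)
    (P : Measure Ω) (ξ : ℝ≥0 → Ω → Config) : Prop where
  measurable : ∀ t, Measurable (ξ t)
  markov : ∀ s t (B : Set Config), MeasurableSet B →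
    P[(ξ (s + t) ⁻¹' B).indicator (fun _ => (1 : ℝ)) | history ξ s]
      =ᵐ[P] fun ω => (S t (ξ s ω)).real B

/-- The joint law `μ_t(z)` of `(ξ_t(z), ξ_t(z+1), …)`, a measure on `{0,1}^ℕ`. -/
noncomputable def lawFrom {Ω : Type*} [MeasurableSpace Ω] (P : Measure Ω)
    (ξ : ℝ≥0 → Ω → Config) (t : ℝ≥0) (z : ℕ) : Measure (ℕ → Bool) :=
  P.map fun ω (k : ℕ) => ξ t ω ((z : ℤ) + (k : ℤ))

/-- A sequence of measures on `{0,1}^ℕ` is decreasing: `ν n ≥ ν (n + 1)` for all `n ≥ 0`. -/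
def IsDecreasing (ν : ℕ → Measure (ℕ → Bool)) : Prop :=
  ∀ n, StochLE (ν (n + 1)) (ν n)

end SpinSystem

namespace SpinSystem

/-! The shifted step lies below the step, so attractiveness, applied to the two point masses, orders
the laws at time `t`. It remains to see that starting from the shifted step amounts to shifting the
law started from the step, i.e. that `S t` commutes with `shift` (`IsSpinSemigroup.map_shift`).

The semigroup is known only through its generator on cylinder functions, so this needs a uniqueness
argument. For a cylinder function `f`, let `D_f(t)` be the difference between integrating `f ∘
shift` from `η` and `f` from `shift η`. Since the pregenerator `L` commutes with `shift`, `D_f` has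
right derivative `D_{Lf}`, and `D_f(0) = 0`. With bounded rates of finite range, `L` widens the
support by a fixed amount and multiplies the sup bound by a factor linear in the width. Iterating
`n` times bounds `D_f(t)` by a term that vanishes as `n → ∞` for small `t`; the semigroup property
then reaches all `t`. -/

/-- Translation of configurations by one site to the left. -/
def shift (η : Config) : Config := fun u => η (u + 1)

lemma continuous_shift : Continuous shift :=
  continuous_pi fun u => continuous_apply (u + 1)

lemma measurable_shift : Measurable shift :=
  measurable_pi_lambda _ fun u => measurable_pi_apply (u + 1)

lemma shift_flip (η : Config) (x : ℤ) : shift (flip η (x + 1)) = flip (shift η) x := by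
  funext u
  simp only [shift, flip, Function.update_apply, add_left_inj]

lemma shift_step_le : shift step ≤ step := by
  intro u
  simp only [shift, step]
  by_cases h : u + 1 ≤ 0
  · simp [h, show u ≤ 0 by omega]
  · simp [h]

lemma continuous_of_dependsOn {f : Config → ℝ} {A : Finset ℤ} (hf : DependsOn f (A : Set ℤ)) :
    Continuous f := by
  obtain ⟨g, rfl⟩ := dependsOn_iff_exists_comp.1 hf
  have hg : Continuous g := continuous_of_discreteTopology
  exact hg.comp (continuous_pi fun u => continuous_apply u.1)

lemma DependsOn.shift {f : Config → ℝ} {A : Finset ℤ} (hf : DependsOn f (A : Set ℤ)) :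
    DependsOn (f ∘ shift) (A.image (· + 1) : Set ℤ) := by
  intro η ζ h
  refine hf fun u hu => h (u + 1) ?_
  exact Finset.mem_coe.2 (Finset.mem_image_of_mem _ hu)

lemma integrable_of_continuous {μ : Measure Config} [IsFiniteMeasure μ] {f : Config → ℝ}
    (hf : Continuous f) : Integrable f μ := by
  obtain ⟨C, hC⟩ := isCompact_univ.exists_bound_of_continuousOn hf.continuousOn
  exact Integrable.of_bound hf.aestronglyMeasurable C (ae_of_all _ fun η => hC η (Set.mem_univ η))

lemma abs_integral_le {μ : Measure Config} [IsProbabilityMeasure μ] {f : Config → ℝ} {M : ℝ}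
    (hf : ∀ η, |f η| ≤ M) : |∫ η, f η ∂μ| ≤ M := by
  have := norm_integral_le_of_norm_le_const (μ := μ) (f := f) (C := M) (ae_of_all _ hf)
  simpa using this

lemma tendsto_integral_of_tendstoUniformly {ι : Type*} {l : Filter ι} [l.IsCountablyGenerated]
    {μ : Measure Config} [IsProbabilityMeasure μ] {F : ι → Config → ℝ} {f : Config → ℝ}
    (hF : ∀ i, Continuous (F i)) (hf : Continuous f) (h : TendstoUniformly F f l) :
    Tendsto (fun i => ∫ η, F i η ∂μ) l (𝓝 (∫ η, f η ∂μ)) := by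
  refine tendsto_integral_filter_of_dominated_convergence (fun η => |f η| + 1)
    (Eventually.of_forall fun i => (hF i).aestronglyMeasurable) ?_
    (integrable_of_continuous (by fun_prop)) (ae_of_all _ fun η => h.tendsto_at η)
  filter_upwards [Metric.tendstoUniformly_iff.1 h 1 one_pos] with i hi
  refine ae_of_all _ fun η => ?_
  have h1 := hi η
  rw [Real.dist_eq] at h1
  rw [Real.norm_eq_abs]
  have h2 := abs_sub_abs_le_abs_sub (F i η) (f η)
  rw [abs_sub_comm] at h2
  linarith

/-! ### The pregenerator on cylinder functions: covariance, support and size. -/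

section Pregenerator

variable {c : ℤ → Config → ℝ}

lemma pregenerator_comp_shift (hc : IsFlipRate c) (f : Config → ℝ) (η : Config) :
    pregenerator c (f ∘ shift) η = pregenerator c f (shift η) := by
  unfold pregenerator
  rw [← (Equiv.addRight (1 : ℤ)).tsum_eq]
  refine tsum_congr fun x => ?_
  simp only [Equiv.coe_addRight, Function.comp_apply, shift_flip]
  rw [hc.translation_invariant x 1 η]
  rfl

lemma apply_flip_of_dependsOn {f : Config → ℝ} {A : Finset ℤ} (hf : DependsOn f (A : Set ℤ))
    (η : Config) {x : ℤ} (hx : x ∉ A) : f (flip η x) = f η := by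
  refine hf fun u hu => Function.update_of_ne ?_ _ _
  rintro rfl
  exact hx hu

lemma pregenerator_eq_sum {f : Config → ℝ} {A : Finset ℤ} (hf : DependsOn f (A : Set ℤ))
    (η : Config) : pregenerator c f η = ∑ x ∈ A, c x η * (f (flip η x) - f η) :=
  tsum_eq_sum fun x hx => by rw [apply_flip_of_dependsOn hf η hx, sub_self, mul_zero]

/-- Translation invariance carries the range at the origin to every site. Taking `1 ≤ R` later lets
`2 * R * j + 1` be absorbed into `3 * R * j`. -/
lemma IsFlipRate.exists_range (hc : IsFlipRate c) :
    ∃ R : ℕ, 1 ≤ R ∧ ∀ x, DependsOn (c x) (Finset.Icc (x - R) (x + R) : Set ℤ) := by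
  obtain ⟨A, hA⟩ := hc.finite_range 0
  refine ⟨A.sup Int.natAbs + 1, by omega, fun x η ζ h => ?_⟩
  have key : ∀ η, c x η = c 0 (fun u => η (u + x)) := fun η => by
    simpa using hc.translation_invariant 0 x η
  rw [key, key]
  refine hA fun u hu => h (u + x) ?_
  have : u.natAbs ≤ A.sup Int.natAbs := Finset.le_sup (f := Int.natAbs) hu
  simp only [Finset.coe_Icc, Set.mem_Icc]
  omega

lemma DependsOn.pregenerator {R : ℕ}
    (hR : ∀ x, DependsOn (c x) (Finset.Icc (x - R) (x + R) : Set ℤ)) {f : Config → ℝ} {m : ℤ}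
    (hf : DependsOn f (Finset.Icc (-m) m : Set ℤ)) :
    DependsOn (pregenerator c f) (Finset.Icc (-(m + R)) (m + R) : Set ℤ) := by
  intro η ζ h
  have hηζ : ∀ u ∈ Finset.Icc (-m) m, η u = ζ u := fun u hu => h u (by
    simp only [Finset.coe_Icc, Set.mem_Icc, Finset.mem_Icc] at hu ⊢; omega)
  rw [pregenerator_eq_sum hf, pregenerator_eq_sum hf]
  refine Finset.sum_congr rfl fun x hx => ?_
  congr 1
  · refine hR x fun u hu => h u ?_
    simp only [Finset.coe_Icc, Set.mem_Icc, Finset.mem_Icc] at hu hx ⊢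
    omega
  · congr 1
    · refine hf fun u hu => ?_
      simp only [flip, Function.update_apply, hηζ u hu, hηζ x hx]
    · exact hf fun u hu => hηζ u hu

lemma abs_pregenerator_le (hc : IsFlipRate c) {C : ℝ} (hC : ∀ x η, c x η ≤ C) {f : Config → ℝ}
    {A : Finset ℤ} (hf : DependsOn f (A : Set ℤ)) {M : ℝ} (hM : ∀ η, |f η| ≤ M) (η : Config) :
    |pregenerator c f η| ≤ A.card * (2 * C * M) := by
  rw [pregenerator_eq_sum hf, ← nsmul_eq_mul]
  refine (Finset.abs_sum_le_sum_abs _ _).trans (Finset.sum_le_card_nsmul _ _ _ fun x _ => ?_)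
  rw [abs_mul, abs_of_nonneg (hc.nonneg x η)]
  have h1 : |f (flip η x) - f η| ≤ 2 * M := by
    have := abs_sub (f (flip η x)) (f η)
    linarith [hM (flip η x), hM η]
  calc c x η * |f (flip η x) - f η| ≤ C * (2 * M) :=
        mul_le_mul (hC x η) h1 (abs_nonneg _) ((hc.nonneg x η).trans (hC x η))
    _ = 2 * C * M := by ring

end Pregenerator

/-! ### Forward equation, translation covariance and one-time laws. -/

section Semigroup

variable {c : ℤ → Config → ℝ} {S : ℝ≥0 → Kernel Config Config}

lemma IsFellerSemigroup.integral_add (hS : IsFellerSemigroup S) (s t : ℝ≥0) {f : Config → ℝ}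
    (hf : Continuous f) (η : Config) :
    ∫ ζ, f ζ ∂(S (s + t) η) = ∫ ζ, ∫ ζ', f ζ' ∂(S t ζ) ∂(S s η) := by
  have := hS.markov
  rw [hS.add, Kernel.integral_comp]
  exact integrable_of_continuous hf

lemma tendsto_toNNReal_sub (t : ℝ) :
    Tendsto (fun u : ℝ => (u - t).toNNReal) (𝓝[>] t) (𝓝[>] 0) := by
  refine tendsto_nhdsWithin_iff.2 ⟨?_, ?_⟩
  · have h : Continuous fun u : ℝ => (u - t).toNNReal := by fun_prop
    simpa using (h.tendsto t).mono_left nhdsWithin_le_nhds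
  · filter_upwards [self_mem_nhdsWithin] with u hu
    simpa using hu

lemma toNNReal_eq_add_sub {t u : ℝ} (ht : 0 ≤ t) (hu : t ≤ u) :
    u.toNNReal = t.toNNReal + (u - t).toNNReal := by
  rw [← Real.toNNReal_add ht (sub_nonneg.2 hu), add_sub_cancel]

/-- Kolmogorov's forward equation: write the increment as `S(t)(S(h)f - f)` and pass the uniform
limit defining the generator through `S(t)`. Only the right derivative comes out directly. -/
lemma IsSpinSemigroup.hasDerivWithinAt (hS : IsSpinSemigroup c S) {f : Config → ℝ}
    {A : Finset ℤ} (hf : DependsOn f (A : Set ℤ)) (hLf : Continuous (pregenerator c f))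
    (η : Config) {t : ℝ} (ht : 0 ≤ t) :
    HasDerivWithinAt (fun u : ℝ => ∫ ζ, f ζ ∂(S u.toNNReal η))
      (∫ ζ, pregenerator c f ζ ∂(S t.toNNReal η)) (Set.Ici t) t := by
  have := hS.markov
  have hfc := continuous_of_dependsOn hf
  have hcont : ∀ h, Continuous fun ζ => ∫ ζ', f ζ' ∂(S h ζ) := fun h => hS.feller h ⟨f, hfc⟩
  rw [hasDerivWithinAt_iff_tendsto_slope, Set.Ici_sdiff_left]
  have key := (tendsto_integral_of_tendstoUniformly (μ := S t.toNNReal η)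
    (F := fun h ζ => (∫ ζ', f ζ' ∂(S h ζ) - f ζ) / (h : ℝ))
    (fun h => ((hcont h).sub hfc).div_const _) hLf
    (hS.generator ⟨f, hfc⟩ A hf)).comp (tendsto_toNNReal_sub t)
  refine key.congr' ?_
  filter_upwards [self_mem_nhdsWithin] with u hu
  have hu' : t ≤ u := le_of_lt hu
  simp only [Function.comp_apply]
  rw [integral_div, integral_sub (integrable_of_continuous (hcont _))
    (integrable_of_continuous hfc), ← hS.integral_add _ _ hfc, ← toNNReal_eq_add_sub ht hu',
    slope_def_field, Real.coe_toNNReal _ (sub_nonneg.2 hu')]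

lemma IsFellerSemigroup.continuousOn (hS : IsFellerSemigroup S) {f : Config → ℝ}
    (hf : Continuous f) (η : Config) :
    ContinuousOn (fun u : ℝ => ∫ ζ, f ζ ∂(S u.toNNReal η)) (Set.Ici 0) := by
  have := hS.markov
  rw [Metric.continuousOn_iff]
  intro t ht ε hε
  have h0 := Metric.tendstoUniformly_iff.1 (hS.strongly_continuous ⟨f, hf⟩) (ε / 2) (half_pos hε)
  have h1 := (tendsto_toNNReal_sub 0).eventually h0
  obtain ⟨δ, hδ, h2⟩ := mem_nhdsGT_iff_exists_Ioo_subset.1 h1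
  have hδ' : (0 : ℝ) < δ := hδ
  -- The bound depends only on `b - a`, because `S(a)` is a contraction; this gives left as well as
  -- right continuity.
  have key : ∀ a b : ℝ, 0 ≤ a → a ≤ b → b - a < δ →
      |∫ ζ, f ζ ∂(S b.toNNReal η) - ∫ ζ, f ζ ∂(S a.toNNReal η)| < ε := by
    intro a b ha hab hba
    rcases hab.eq_or_lt with rfl | hlt
    · simpa using hε
    have h3 := h2 ⟨sub_pos.2 hlt, hba⟩
    simp only [Set.mem_ofPred_eq, sub_zero, ContinuousMap.coe_mk, Real.dist_eq] at h3
    have hcont : Continuous fun ζ => ∫ ζ', f ζ' ∂(S (b - a).toNNReal ζ) := hS.feller _ ⟨f, hf⟩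
    rw [toNNReal_eq_add_sub ha hab, hS.integral_add _ _ hf, ← integral_sub
      (integrable_of_continuous hcont) (integrable_of_continuous hf)]
    refine (abs_integral_le (M := ε / 2) fun ζ => ?_).trans_lt (half_lt_self hε)
    rw [abs_sub_comm]
    exact (h3 ζ).le
  refine ⟨δ, hδ', fun u hu hut => ?_⟩
  rw [Real.dist_eq] at hut ⊢
  rcases le_total t u with h | h
  · exact key t u ht h ((le_abs_self _).trans_lt hut)
  · rw [abs_sub_comm] at hut ⊢
    exact key u t hu h ((le_abs_self _).trans_lt hut)

/-- Cylinder functions are analytic vectors of the pregenerator: iterating the generator `n` times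
bounds the defect of translation covariance by the `n`-th term of a geometric-type series. -/
lemma IsSpinSemigroup.abs_integral_shift_sub_le (hc : IsFlipRate c) (hS : IsSpinSemigroup c S)
    {R : ℕ} (hR1 : 1 ≤ R) (hR : ∀ x, DependsOn (c x) (Finset.Icc (x - R) (x + R) : Set ℤ))
    {C : ℝ} (hC : ∀ x η, c x η ≤ C) (η : Config) (n : ℕ) :
    ∀ (j : ℕ) (M : ℝ) (f : Config → ℝ), 1 ≤ j →
      DependsOn f (Finset.Icc (-(R * j : ℤ)) (R * j) : Set ℤ) → (∀ ζ, |f ζ| ≤ M) →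
      ∀ t : ℝ, 0 ≤ t →
        |∫ ζ, f (shift ζ) ∂(S t.toNNReal η) - ∫ ζ, f ζ ∂(S t.toNNReal (shift η))| ≤
          2 * M * ((6 * C * R * t) ^ n * (j + n - 1).choose n) := by
  have := hS.markov
  have hC0 : 0 ≤ C := (hc.nonneg 0 η).trans (hC 0 η)
  induction n with
  | zero =>
    intro j M f _ _ hM t _
    have h1 := abs_integral_le (μ := S t.toNNReal η) (f := fun ζ => f (shift ζ))
      fun ζ => hM (shift ζ)
    have h2 := abs_integral_le (μ := S t.toNNReal (shift η)) hM
    have h3 := abs_sub (∫ ζ, f (shift ζ) ∂(S t.toNNReal η))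
      (∫ ζ, f ζ ∂(S t.toNNReal (shift η)))
    simp only [pow_zero, Nat.choose_zero_right, Nat.cast_one]
    linarith
  | succ n ih =>
    intro j M f hj hf hM T hT
    have hM0 : 0 ≤ M := (abs_nonneg _).trans (hM η)
    have hLf : DependsOn (pregenerator c f)
        (Finset.Icc (-(R * (j + 1 : ℕ) : ℤ)) (R * (j + 1 : ℕ)) : Set ℤ) := by
      have := DependsOn.pregenerator hR hf
      rwa [show (R * j + R : ℤ) = R * (j + 1 : ℕ) by push_cast; ring] at this
    have hLM : ∀ ζ, |pregenerator c f ζ| ≤ 6 * C * R * j * M := by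
      intro ζ
      refine (abs_pregenerator_le hc hC hf hM ζ).trans ?_
      have hcard : ((Finset.Icc (-(R * j : ℤ)) (R * j)).card : ℝ) ≤ 3 * (R * j) := by
        rw [Int.card_Icc]
        have h1 : 1 ≤ R * j := Nat.mul_pos hR1 hj
        have h2 : ((R * j + 1 - -(R * j) : ℤ)).toNat ≤ 3 * (R * j) := by
          zify at h1 ⊢; omega
        exact_mod_cast h2
      calc _ ≤ 3 * (R * j) * (2 * C * M) := by gcongr
        _ = _ := by ring
    have hLc := continuous_of_dependsOn hLf
    have hfs := DependsOn.shift hf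
    have hLs : pregenerator c (f ∘ shift) = pregenerator c f ∘ shift :=
      funext fun ζ => pregenerator_comp_shift hc f ζ
    have hfc := continuous_of_dependsOn hf
    have hderiv : ∀ t ∈ Set.Ico 0 T, HasDerivWithinAt
        (fun t : ℝ => ∫ ζ, f (shift ζ) ∂(S t.toNNReal η) - ∫ ζ, f ζ ∂(S t.toNNReal (shift η)))
        (∫ ζ, pregenerator c f (shift ζ) ∂(S t.toNNReal η) -
          ∫ ζ, pregenerator c f ζ ∂(S t.toNNReal (shift η))) (Set.Ici t) t := by
      intro t ht
      have h1 := hS.hasDerivWithinAt hfs (by rw [hLs]; exact hLc.comp continuous_shift) η ht.1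
      rw [hLs] at h1
      exact h1.sub (hS.hasDerivWithinAt hf hLc (shift η) ht.1)
    have hcont : ContinuousOn
        (fun t : ℝ => ∫ ζ, f (shift ζ) ∂(S t.toNNReal η) - ∫ ζ, f ζ ∂(S t.toNNReal (shift η)))
        (Set.Icc 0 T) :=
      ((hS.continuousOn (hfc.comp continuous_shift) η).sub
        (hS.continuousOn hfc (shift η))).mono fun t ht => ht.1
    -- The derivative of the bound for `(n + 1, j, M)` is exactly the bound for `(n, j + 1, 6 * C *
    -- R * j * M)`, by `(n+1) * choose (j+n) (n+1) = j * choose (j+n) n`.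
    have hB : ∀ t : ℝ, HasDerivAt
        (fun t : ℝ => 2 * M * ((6 * C * R * t) ^ (n + 1) * (j + (n + 1) - 1).choose (n + 1)))
        (2 * (6 * C * R * j * M) * ((6 * C * R * t) ^ n * (j + 1 + n - 1).choose n)) t := by
      intro t
      have h1 : HasDerivAt (fun t : ℝ => 6 * C * R * t) (6 * C * R) t := by
        simpa using (hasDerivAt_id t).const_mul (6 * C * R)
      have h2 := ((h1.pow (n + 1)).mul_const
        (((j + (n + 1) - 1).choose (n + 1) : ℕ) : ℝ)).const_mul (2 * M)
      refine h2.congr_deriv ?_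
      have h3 := Nat.choose_succ_right_eq (j + n) n
      have h4 : ((j + n).choose (n + 1) : ℝ) * (n + 1) = (j + n).choose n * j := by
        have : j + n - n = j := by omega
        rw [this] at h3
        exact_mod_cast h3
      rw [show j + (n + 1) - 1 = j + n by omega, show j + 1 + n - 1 = j + n by omega,
        Nat.add_sub_cancel]
      push_cast
      linear_combination (2 * M * (6 * C * R) * (6 * C * R * t) ^ n) * h4
    refine image_norm_le_of_norm_deriv_right_le_deriv_boundary hcont hderiv ?_ hB ?_
      (Set.right_mem_Icc.2 hT)
    · simp [hS.zero, Kernel.id_apply]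
    · intro t ht
      exact ih (j + 1) _ _ (by omega) hLf hLM t ht.1

/-- The binomial coefficient is at most `2 ^ (j + n)`, which turns the iterated bound into a
geometric sequence of ratio `12 * C * R * t`. -/
lemma IsSpinSemigroup.integral_shift_of_small (hc : IsFlipRate c) (hS : IsSpinSemigroup c S)
    {R : ℕ} (hR1 : 1 ≤ R) (hR : ∀ x, DependsOn (c x) (Finset.Icc (x - R) (x + R) : Set ℤ))
    {C : ℝ} (hC : ∀ x η, c x η ≤ C) {t : ℝ≥0} (ht : 12 * C * R * t < 1) (η : Config)
    {f : Config → ℝ} {A : Finset ℤ} (hf : DependsOn f (A : Set ℤ)) {M : ℝ}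
    (hM : ∀ ζ, |f ζ| ≤ M) :
    ∫ ζ, f (shift ζ) ∂(S t η) = ∫ ζ, f ζ ∂(S t (shift η)) := by
  have hC0 : 0 ≤ C := (hc.nonneg 0 η).trans (hC 0 η)
  have hM0 : 0 ≤ M := (abs_nonneg _).trans (hM η)
  set j : ℕ := A.sup Int.natAbs + 1 with hj
  have hfj : DependsOn f (Finset.Icc (-(R * j : ℤ)) (R * j) : Set ℤ) := by
    refine hf.mono fun u hu => ?_
    have h1 : u.natAbs ≤ A.sup Int.natAbs := Finset.le_sup (f := Int.natAbs) hu
    have h2 : 1 * j ≤ R * j := Nat.mul_le_mul_right j hR1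
    have h3 : ((R * j : ℕ) : ℤ) = R * j := by push_cast; rfl
    rw [← h3]
    simp only [Finset.coe_Icc, Set.mem_Icc]
    omega
  have hbound : ∀ n : ℕ, |∫ ζ, f (shift ζ) ∂(S t η) - ∫ ζ, f ζ ∂(S t (shift η))| ≤
      2 * M * 2 ^ j * (12 * C * R * t) ^ n := by
    intro n
    have h1 := hS.abs_integral_shift_sub_le hc hR1 hR hC η n j M f (by omega) hfj hM t t.2
    rw [Real.toNNReal_coe] at h1
    refine h1.trans ?_
    have h2 : ((j + n - 1).choose n : ℝ) ≤ 2 ^ j * 2 ^ n := by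
      rw [← pow_add]
      have h3 := (Nat.choose_le_two_pow (j + n - 1) n).trans
        (Nat.pow_le_pow_right two_pos (Nat.sub_le (j + n) 1))
      exact_mod_cast h3
    calc 2 * M * ((6 * C * R * t) ^ n * (j + n - 1).choose n)
        ≤ 2 * M * ((6 * C * R * t) ^ n * (2 ^ j * 2 ^ n)) := by gcongr
      _ = 2 * M * 2 ^ j * (12 * C * R * t) ^ n := by
        rw [show (12 * C * R * t : ℝ) = 6 * C * R * t * 2 by ring, mul_pow _ 2]; ring
  have hlim : Tendsto (fun n : ℕ => 2 * M * 2 ^ j * (12 * C * R * t : ℝ) ^ n) atTop (𝓝 0) := by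
    simpa using (tendsto_pow_atTop_nhds_zero_of_lt_one (by positivity) ht).const_mul
      (2 * M * 2 ^ j)
  exact sub_eq_zero.1 (abs_nonpos_iff.1 (ge_of_tendsto' hlim hbound))

lemma measure_ext_of_dependsOn {μ ν : Measure Config} [IsProbabilityMeasure μ]
    [IsProbabilityMeasure ν]
    (h : ∀ (f : Config → ℝ) (A : Finset ℤ), DependsOn f (A : Set ℤ) → (∀ ζ, |f ζ| ≤ 1) →
      ∫ ζ, f ζ ∂μ = ∫ ζ, f ζ ∂ν) : μ = ν := by
  refine ext_of_generate_finite (measurableCylinders fun _ : ℤ => Bool)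
    generateFrom_measurableCylinders.symm isPiSystem_measurableCylinders (fun s hs => ?_) (by simp)
  have hsm := MeasurableSet.of_mem_measurableCylinders hs
  obtain ⟨A, T, -, rfl⟩ := (mem_measurableCylinders s).1 hs
  have key := h ((cylinder A T).indicator fun _ => 1) A (dependsOn_cylinder_indicator_const (α := fun _ => Bool) T 1)
    fun ζ => by
      by_cases hζ : ζ ∈ cylinder A T <;> simp [hζ]
  rw [integral_indicator_const _ hsm, integral_indicator_const _ hsm] at key
  simp only [smul_eq_mul, mul_one] at key
  exact (measureReal_eq_measureReal_iff (by finiteness) (by finiteness)).1 key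

/-- The semigroup of a spin system commutes with translations. -/
theorem IsSpinSemigroup.map_shift (hc : IsFlipRate c) (hS : IsSpinSemigroup c S) (t : ℝ≥0) :
    (S t).map shift = (S t).comap shift measurable_shift := by
  have := hS.markov
  obtain ⟨C, hC⟩ := hc.bounded
  obtain ⟨R, hR1, hR⟩ := hc.exists_range
  have hsmall : ∀ t : ℝ≥0, 12 * C * R * t < 1 →
      (S t).map shift = (S t).comap shift measurable_shift := by
    intro t ht
    ext1 η
    rw [Kernel.map_apply _ measurable_shift, Kernel.comap_apply]
    have := Measure.isProbabilityMeasure_map (μ := S t η) measurable_shift.aemeasurable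
    refine measure_ext_of_dependsOn fun f A hf hM => ?_
    rw [integral_map measurable_shift.aemeasurable
      (continuous_of_dependsOn hf).aestronglyMeasurable]
    exact hS.integral_shift_of_small hc hR1 hR hC ht η hf hM
  have hadd : ∀ s t : ℝ≥0, (S s).map shift = (S s).comap shift measurable_shift →
      (S t).map shift = (S t).comap shift measurable_shift →
      (S (s + t)).map shift = (S (s + t)).comap shift measurable_shift := by
    intro s t hs ht
    rw [hS.add, Kernel.map_comp, ht, ← Kernel.comp_map _ _ measurable_shift, hs]
    ext1 η
    rw [Kernel.comp_apply, Kernel.comap_apply, Kernel.comap_apply, Kernel.comp_apply]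
  have hmul : ∀ (s : ℝ≥0), 12 * C * R * s < 1 → ∀ n : ℕ,
      (S (n * s)).map shift = (S (n * s)).comap shift measurable_shift := by
    intro s hs n
    induction n with
    | zero => exact hsmall _ (by simp)
    | succ n ih =>
      rw [Nat.cast_succ, add_mul, one_mul]
      exact hadd _ _ ih (hsmall s hs)
  obtain ⟨n, hn⟩ := exists_nat_gt (12 * C * R * t)
  -- Cut `t` into `n + 1` equal steps, each below the smallness threshold.
  have hn1 : (0 : ℝ) < (n + 1 : ℕ) := by positivity
  have h := hmul (t / (n + 1 : ℕ)) (by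
    rw [NNReal.coe_div, NNReal.coe_natCast, ← mul_div_assoc, div_lt_one hn1]
    push_cast
    linarith) (n + 1)
  rwa [mul_div_cancel₀ _ (by positivity)] at h

/-- Take expectations in the Markov property at time `0`, where the state is almost surely `η`. -/
lemma IsMarkovProcess.map_eq {Ω : Type*} [MeasurableSpace Ω] {P : Measure Ω}
    [IsProbabilityMeasure P] {ξ : ℝ≥0 → Ω → Config} (hS : IsFellerSemigroup S)
    (hξ : IsMarkovProcess S P ξ) {η : Config} (h0 : ∀ᵐ ω ∂P, ξ 0 ω = η) (t : ℝ≥0) :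
    P.map (ξ t) = S t η := by
  have := hS.markov
  have := Measure.isProbabilityMeasure_map (μ := P) (hξ.measurable t).aemeasurable
  ext B hB
  have hle : history ξ 0 ≤ ‹MeasurableSpace Ω› :=
    iSup_le fun r => (hξ.measurable r).comap_le
  have h1 := integral_congr_ae (hξ.markov 0 t B hB)
  rw [integral_condExp hle, zero_add, integral_indicator_const _ (hξ.measurable t hB),
    integral_congr_ae (g := fun _ => (S t η).real B) (h0.mono fun ω hω => by simp only [hω])] at h1
  simp only [smul_eq_mul, mul_one, integral_const, probReal_univ, one_mul] at h1
  rw [Measure.map_apply (hξ.measurable t) hB]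
  exact (measureReal_eq_measureReal_iff (by finiteness) (by finiteness)).1 h1

end Semigroup

end SpinSystem

/-! ### Monotonicity of the laws seen from `z`. -/

theorem theorem1 {Ω : Type*} [MeasurableSpace Ω] (P : Measure Ω) [IsProbabilityMeasure P]
    (c : ℤ → SpinSystem.Config → ℝ) (hc : SpinSystem.IsFlipRate c)
    (S : ℝ≥0 → Kernel SpinSystem.Config SpinSystem.Config)
    (hS : SpinSystem.IsSpinSemigroup c S) (hattr : SpinSystem.IsAttractive S)
    (ξ : ℝ≥0 → Ω → SpinSystem.Config) (hξ : SpinSystem.IsMarkovProcess S P ξ)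
    (h0 : ∀ᵐ ω ∂P, ξ 0 ω = SpinSystem.step) (t : ℝ≥0) :
    SpinSystem.IsDecreasing (SpinSystem.lawFrom P ξ t) := by
  intro z f hf hmono hbdd
  let π : SpinSystem.Config → ℕ → Bool := fun η k => η ((z : ℤ) + (k : ℤ))
  have hπ : Measurable π := measurable_pi_lambda _ fun k => measurable_pi_apply _
  have hlaw : ∀ g : SpinSystem.Config → ℕ → Bool, Measurable g →
      P.map (fun ω => g (ξ t ω)) = (S t SpinSystem.step).map g := fun g hg => by
    rw [← hξ.map_eq hS.toIsFellerSemigroup h0 t, Measure.map_map hg (hξ.measurable t)]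
    rfl
  have hz : SpinSystem.lawFrom P ξ t z = (S t SpinSystem.step).map π := hlaw π hπ
  have hz1 : SpinSystem.lawFrom P ξ t (z + 1) =
      (S t (SpinSystem.shift SpinSystem.step)).map π := by
    have h1 := hlaw (π ∘ SpinSystem.shift) (hπ.comp SpinSystem.measurable_shift)
    have h2 := DFunLike.congr_fun (hS.map_shift hc t) SpinSystem.step
    rw [Kernel.map_apply _ SpinSystem.measurable_shift, Kernel.comap_apply] at h2
    rw [← h2, Measure.map_map hπ SpinSystem.measurable_shift, ← h1]
    unfold SpinSystem.lawFrom
    congr 1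
    funext ω k
    simp only [π, Function.comp_apply, SpinSystem.shift]
    congr 1
    push_cast
    ring
  have hdirac : SpinSystem.StochLE (Measure.dirac (SpinSystem.shift SpinSystem.step))
      (Measure.dirac SpinSystem.step) := fun g hg hgm _ => by
    rw [integral_dirac' _ _ hg.stronglyMeasurable, integral_dirac' _ _ hg.stronglyMeasurable]
    exact hgm SpinSystem.shift_step_le
  -- Restriction to the sites from `z` onwards is increasing, so `f ∘ π` is an admissible test
  -- function.
  have key := hattr _ _ inferInstance inferInstance hdirac t (f ∘ π) (hf.comp hπ)
    (hmono.comp fun η ζ h k => h _) (hbdd.imp fun C hC η => hC (π η))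
  rw [Measure.dirac_bind (S t).measurable, Measure.dirac_bind (S t).measurable] at key
  rw [hz, hz1, integral_map hπ.aemeasurable hf.aestronglyMeasurable,
    integral_map hπ.aemeasurable hf.aestronglyMeasurable]
  exact key
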